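/- A partial applicative structure is a set $A$ with a partial map $\cdot : A\times A\rightharpoonup A$; write $ab$ for $a\cdot b$, associate to the left, let application be strict ($t_1t_2$ is defined only if $t_1$ and $t_2$ are), and write $t\simeq t'$ if $t,t'$ are both undefined or both defined and equal. It is extensional if for all $f,g\in A$: whenever $fa\simeq ga$ for all $a\in A$, then $f=g$. An element $k\in A$ is a combinator $k$ if $ka$ is defined for every $a\in A$ and $kab=a$ (in particular is defined) for all $a,b\in A$. An element $s\in A$ is a combinator $s$ if for all $a,b,c\in A$, $sab$ is defined and $sabc\simeq ac(bc)$. A 1-1 computable enumeration of the unary partial computable functions is a sequence $(\psi_n)_{n\in\omega}$ of partial functions $\omega\rightharpoonup\omega$ such that $(n,m)\mapsto\psi_n(m)$ is partial computable, $\psi_n\neq\psi_m$ for $n\neq m$, and every unary partial computable function equals $\psi_n$ for some $n$. It makes $\omega$ (with $n$ standing for the function $\psi_n$) a partial applicative structure with application $n\cdot m=\psi_n(m)$. Theorem 6.2. (i) There is a 1-1 computable enumeration $\psi$ of the unary partial computable functions for which the partial applicative structure $\omega$ with $n\cdot m=\psi_n(m)$ is extensional and has a combinator $k$. (ii) There is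 no 1-1 computable enumeration $\psi$ of the unary partial computable functions for which the partial applicative structure $\omega$ with $n\cdot m=\psi_n(m)$ has a combinator $s$. -/

import Mathlib

/-- A partial applicative structure: a set `A` with a partial binary application map.
Equality in `Part A` is Kleene equality: both sides undefined, or both defined and equal. -/
structure PartialApplicativeStructure (A : Type*) where
  /-- The partial application map. -/
  app : A → A → Part A

namespace PartialApplicativeStructure

variable {A : Type*} (P : PartialApplicativeStructure A)

/-- Strict application of possibly undefined values of closed terms: `x y` is defined iff
`x` and `y` are both defined and the application of their values is defined. -/
def sapp (x y : Part A) : Part A :=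
  x.bind fun a => y.bind fun b => P.app a b

/-- Extensionality: if `f a ≃ g a` for every `a`, then `f = g`. -/
def Extensional : Prop :=
  ∀ f g : A, (∀ a : A, P.app f a = P.app g a) → f = g

/-- `k` is a `k`-combinator: `k` is total, and `k a b` is defined with value `a`. -/
def IsCombinatorK (k : A) : Prop :=
  (∀ a : A, (P.app k a).Dom) ∧
    ∀ a b : A, P.sapp (P.app k a) (Part.some b) = Part.some a

/-- `s` is an `s`-combinator: `s a b` is defined, and `s a b c ≃ (a c) (b c)`. -/
def IsCombinatorS (s : A) : Prop :=
  (∀ a b : A, (P.sapp (P.app s a) (Part.some b)).Dom) ∧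
    ∀ a b c : A,
      P.sapp (P.sapp (P.app s a) (Part.some b)) (Part.some c) =
        P.sapp (P.app a c) (P.app b c)

end PartialApplicativeStructure

/-- `ψ` is a computable enumeration without repetitions of all unary partial computable
functions: it is uniformly partial computable, it is injective, and every unary partial
computable function occurs in it. -/
structure IsOneOneComputableEnumeration (ψ : ℕ → ℕ →. ℕ) : Prop where
  /-- The binary partial function `(n, m) ↦ ψ n m` is partial computable. -/
  computable : Partrec₂ ψ
  /-- There are no repetitions. -/
  injective : Function.Injective ψ
  /-- Every unary partial computable function occurs. -/
  complete : ∀ f : ℕ →. ℕ, Nat.Partrec f → ∃ n : ℕ, ψ n = f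

/-- The partial applicative structure on `ℕ` with `n · m = ψ n m`; here `n` stands for the
function `ψ n`. -/
def enumerationPas (ψ : ℕ → ℕ →. ℕ) : PartialApplicativeStructure ℕ where
  app n m := ψ n m

/-! No combinator `s`: it would make composition with a fixed function on the left computable on
indices (`exists_computable_comp`). Iterating this gives, computably in `n`, an index of `c ↦ ⟨c,
n⟩`; one more composition gives an index of the function that is constantly `0` if program `n` halts
and nowhere defined otherwise. Without repetitions, comparing it with the only index of the zero
function decides the halting problem.

A combinator `k`: extensionality is injectivity of `ψ`, and `k` is an index of any computable map
from `a` to an index of the constant function `a`. What is needed is a Friedberg enumeration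
admitting such a map. The total eventually constant functions have unique, decidable codes; all
other partial computable functions are enumerated with repetitions by `nonconst`. A pair `(e, r)`
follows program `e` as long as `r` looks like the final guess of a bound below which `e` differs
from all smaller indices. One guess survives if `e` is the least index of its function, and none
otherwise. When `r` is refuted, the finitely many outputs so far are completed to an eventually
constant function whose tail records `(e, r, t)`, and its code is struck from the list of codes.
Codes of constant functions are never struck, so their indices stay computable. -/

open Nat.Partrec (Code)
open Nat.Partrec.Code (eval evaln)

/-! ### A combinator `s` would decide the halting problem. -/

namespace IsOneOneComputableEnumeration

variable {ψ : ℕ → ℕ →. ℕ}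

/-- A combinator `s` yields, for every `i`, an index of `ψ i ∘ ψ b` computably in `b`. -/
theorem exists_computable_comp (h : IsOneOneComputableEnumeration ψ) {s : ℕ}
    (hs : (enumerationPas ψ).IsCombinatorS s) (i : ℕ) :
    ∃ T : ℕ → ℕ, Computable T ∧ ∀ b c, ψ (T b) c = (ψ b c).bind fun x => ψ i x := by
  -- With `a` an index of the constant function `i`, `s a b c ≃ (a c) (b c) = i (b c)`.
  obtain ⟨a, ha⟩ := h.complete (fun _ => Part.some i)
    (Partrec.nat_iff.1 (Computable.const i).partrec)
  obtain ⟨hdom, heq⟩ := hs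
  simp only [enumerationPas, PartialApplicativeStructure.sapp, Part.bind_some] at hdom heq
  obtain ⟨u, hu, -⟩ := Part.mem_bind_iff.1 (Part.get_mem (hdom a 0))
  have hsa : ψ s a = Part.some u := Part.eq_some_iff.2 hu
  replace hdom (b : ℕ) : (ψ u b).Dom := by simpa [hsa] using hdom a b
  refine ⟨fun b => (ψ u b).get (hdom b), ?_, fun b c => ?_⟩
  · exact Partrec.of_eq_tot (h.computable.comp (Computable.const u) Computable.id)
      fun b => Part.get_mem _
  · have := heq a b c
    rw [hsa, Part.bind_some, ← Part.some_get (hdom b), Part.bind_some] at this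
    simpa [ha] using this

theorem not_isCombinatorS (h : IsOneOneComputableEnumeration ψ) (s : ℕ) :
    ¬ (enumerationPas ψ).IsCombinatorS s := by
  intro hs
  have hfst : Computable fun n : ℕ => n.unpair.1 := Computable.fst.comp Computable.unpair
  have hsnd : Computable fun n : ℕ => n.unpair.2 := Computable.snd.comp Computable.unpair
  obtain ⟨i, hi⟩ := h.complete (fun n => Part.some (Nat.pair n.unpair.1 (n.unpair.2 + 1)))
    (Partrec.nat_iff.1 (Primrec₂.natPair.to_comp.comp hfst (Computable.succ.comp hsnd)).partrec)
  obtain ⟨b, hb⟩ := h.complete (fun c => Part.some (Nat.pair c 0))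
    (Partrec.nat_iff.1
      (Primrec₂.natPair.to_comp.comp Computable.id (Computable.const 0)).partrec)
  obtain ⟨z, hz⟩ := h.complete (fun _ => Part.some 0)
    (Partrec.nat_iff.1 (Computable.const 0).partrec)
  -- On `⟨c, n⟩`, `j` ignores `c` and returns `0` exactly if program `n` halts on input `0`.
  obtain ⟨j, hj⟩ := h.complete
    (fun n => (eval (Denumerable.ofNat Code n.unpair.2) 0).map fun _ => 0)
    (Partrec.nat_iff.1 (Partrec.map
      (Nat.Partrec.Code.eval_part.comp ((Computable.ofNat Code).comp hsnd) (Computable.const 0))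
      (Computable.const 0).to₂))
  obtain ⟨T, hT, hTψ⟩ := h.exists_computable_comp hs i
  obtain ⟨U, hU, hUψ⟩ := h.exists_computable_comp hs j
  have hB (n c : ℕ) : ψ (T^[n] b) c = Part.some (Nat.pair c n) := by
    induction n with
    | zero => simp [hb]
    | succ n ih => simp [Function.iterate_succ_apply', hTψ, ih, hi]
  have hBcomp : Computable fun n => T^[n] b := by
    refine (Computable.nat_rec Computable.id (Computable.const b)
      (hT.comp (Computable.snd.comp Computable.snd)).to₂).of_eq fun n => ?_
    induction n with
    | zero => rfl
    | succ n ih => simpa [Function.iterate_succ_apply'] using congrArg T ih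
  have key (c : Code) : (eval c 0).Dom ↔ U (T^[Encodable.encode c] b) = z := by
    rw [← h.injective.eq_iff]
    constructor
    · intro hd
      funext x
      rw [hUψ, hB, Part.bind_some, hj, hz]
      simp only [Nat.unpair_pair, Denumerable.ofNat_encode]
      rw [← Part.some_get hd, Part.map_some]
    · intro he
      have := congrFun he 0
      rw [hUψ, hB, Part.bind_some, hj, hz] at this
      simp only [Nat.unpair_pair, Denumerable.ofNat_encode] at this
      have h2 : ((eval c 0).map fun _ => 0).Dom := by rw [this]; trivial
      exact h2
  refine ComputablePred.halting_problem 0 (ComputablePred.of_eq (p := fun c =>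
    U (T^[Encodable.encode c] b) = z) ?_ fun c => (key c).symm)
  exact Computable.computablePred ((Primrec.eq (α := ℕ)).decide.to_comp.comp
    (hU.comp (hBcomp.comp Computable.encode)) (Computable.const z))

end IsOneOneComputableEnumeration

/-! ### Unbounded search and listing a decidable set. -/

/-- The searches below are not monotone in the stage, but any two of their outputs agree, which
suffices. -/
theorem Nat.mem_rfindOpt_iff_of_unique {α : Type*} {f : ℕ → Option α}
    (H : ∀ {a b m n}, a ∈ f m → b ∈ f n → a = b) {a : α} :
    a ∈ Nat.rfindOpt f ↔ ∃ n, a ∈ f n := by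
  refine ⟨Nat.rfindOpt_spec, fun ⟨n, h⟩ => ?_⟩
  have hd := Nat.rfindOpt_dom.2 ⟨_, _, h⟩
  obtain ⟨k, hk⟩ := Nat.rfindOpt_spec ⟨hd, rfl⟩
  rw [H h hk]
  exact Part.get_mem hd

theorem Primrec.count {p : ℕ → Prop} [DecidablePred p] (hp : PrimrecPred p) :
    Primrec (Nat.count p) := by
  refine (Primrec.nat_rec₁ (f := fun n c => c + if p n then 1 else 0) 0
    (Primrec.nat_add.comp Primrec.snd (Primrec.ite (hp.comp Primrec.fst)
      (Primrec.const 1) (Primrec.const 0)))).of_eq fun n => ?_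
  induction n with
  | zero => simp
  | succ n ih => rw [Nat.count_succ, ← ih]

theorem Computable.nth {p : ℕ → Prop} (hp : PrimrecPred p) (hinf : {n | p n}.Infinite) :
    Computable (Nat.nth p) := by
  classical
  refine Partrec.of_eq_tot (f := fun k => Nat.rfind fun n =>
    Part.some (decide (p n ∧ Nat.count p n = k))) (Partrec.rfind (Computable.partrec
      (Primrec.to_comp (PrimrecPred.decide ((hp.comp Primrec.snd).and
        (Primrec.eq.comp ((Primrec.count hp).comp Primrec.snd) Primrec.fst)))))) fun k => ?_
  refine Nat.mem_rfind.2 ⟨?_, fun {m} hm => ?_⟩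
  · simpa using ⟨Nat.nth_mem_of_infinite hinf k, Nat.count_nth_of_infinite hinf k⟩
  · have : ¬ (p m ∧ Nat.count p m = k) := fun ⟨hpm, hc⟩ => hm.ne (hc ▸ (Nat.nth_count hpm).symm)
    simpa using this

/-! ### Eventually constant functions and their unique codes. -/

/-- The function whose values are listed by `p.1`, continued by the constant `p.2`. -/
def eventuallyConst (p : List ℕ × ℕ) (x : ℕ) : ℕ := p.1.getD x p.2

/-- The code `p` of an eventually constant function has minimal length. -/
def IsReducedCode (p : List ℕ × ℕ) : Prop := p.1.reverse.head? ≠ some p.2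

/-- A partial function that is total and eventually constant. -/
def EventuallyConst (f : ℕ →. ℕ) : Prop := ∃ p, f = fun x => Part.some (eventuallyConst p x)

theorem primrec_eventuallyConst : Primrec₂ eventuallyConst :=
  (Primrec.option_getD.comp (Primrec.list_getElem?.comp (Primrec.fst.comp Primrec.fst) Primrec.snd)
    (Primrec.snd.comp Primrec.fst)).of_eq fun a => by simp [eventuallyConst, List.getD]

theorem primrecPred_isReducedCode : PrimrecPred IsReducedCode :=
  PrimrecPred.not (Primrec.eq.comp
    (Primrec.list_head?.comp (Primrec.list_reverse.comp Primrec.fst))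
    (Primrec.option_some.comp Primrec.snd))

theorem exists_isReducedCode (l : List ℕ) (c : ℕ) :
    ∃ q, IsReducedCode q ∧ eventuallyConst q = eventuallyConst (l, c) := by
  induction l using List.reverseRecOn with
  | nil => exact ⟨([], c), by simp [IsReducedCode], rfl⟩
  | append_singleton l a ih =>
    by_cases h : a = c
    · obtain ⟨q, hq, he⟩ := ih
      refine ⟨q, hq, he.trans (funext fun x => ?_)⟩
      simp only [eventuallyConst, List.getD, h]
      rcases lt_trichotomy x l.length with hx | hx | hx
      · rw [List.getElem?_append_left hx]
      · simp [hx]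
      · rw [List.getElem?_eq_none (by simpa using hx : (l ++ [c]).length ≤ x),
          List.getElem?_eq_none hx.le]
    · exact ⟨(l ++ [a], c), by simp [IsReducedCode, h], rfl⟩

theorem eventuallyConst_of_length_le {p : List ℕ × ℕ} {x : ℕ} (h : p.1.length ≤ x) :
    eventuallyConst p x = p.2 := by
  simp [eventuallyConst, List.getD, List.getElem?_eq_none h]

/-- If the list of `q` were longer, its last entry would sit where `p` has already reached the
common tail value, so `q` would not be reduced. -/
theorem IsReducedCode.length_le {p q : List ℕ × ℕ} (hq : IsReducedCode q) (hc : p.2 = q.2)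
    (h : eventuallyConst p = eventuallyConst q) : q.1.length ≤ p.1.length := by
  obtain ⟨l, c⟩ := q
  by_contra! hlt
  rcases List.eq_nil_or_concat l with rfl | ⟨l, a, rfl⟩
  · simp at hlt
  · refine hq ?_
    have hx := congrFun h l.length
    rw [eventuallyConst_of_length_le (by simp at hlt; omega), hc] at hx
    simpa [eventuallyConst, eq_comm] using hx

theorem IsReducedCode.eq {p q : List ℕ × ℕ} (hp : IsReducedCode p) (hq : IsReducedCode q)
    (h : eventuallyConst p = eventuallyConst q) : p = q := by
  have hc : p.2 = q.2 := by
    have hx := congrFun h (max p.1.length q.1.length)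
    rwa [eventuallyConst_of_length_le (le_max_left _ _),
      eventuallyConst_of_length_le (le_max_right _ _)] at hx
  have hl := (hp.length_le hc.symm h.symm).antisymm (hq.length_le hc h)
  refine Prod.ext (List.ext_getElem hl fun i h₁ h₂ => ?_) hc
  have hi := congrFun h i
  simpa [eventuallyConst, List.getD, h₁, h₂] using hi

theorem EventuallyConst.exists_isReducedCode {f : ℕ →. ℕ} (hf : EventuallyConst f) :
    ∃ p, IsReducedCode p ∧ f = fun x => Part.some (eventuallyConst p x) := by
  obtain ⟨⟨l, c⟩, rfl⟩ := hf
  obtain ⟨q, hq, he⟩ := _root_.exists_isReducedCode l c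
  exact ⟨q, hq, by rw [he]⟩

/-! ### Enumerating the functions that are not eventually constant. -/

/-- Stage `s` of the computation of a member of an enumeration of the functions that are not
eventually constant. The index `e` codes a program and either a number where the function shall be
undefined, or the demand that every value in the domain be followed by a different one. -/
def nonconstStep (e x s : ℕ) : Option ℕ :=
  (evaln s.unpair.1 (Denumerable.ofNat Code e.unpair.1) x).bind fun y =>
    -- `0` selects the demand for a later, different value, with `s.unpair.2` as the candidate
    -- place; `n + 1` deletes `n` from the domain.
    if e.unpair.2 = 0 then
      (evaln s.unpair.1 (Denumerable.ofNat Code e.unpair.1) s.unpair.2).bind fun z =>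
        if x < s.unpair.2 ∧ y ≠ z then some y else none
    else if x + 1 = e.unpair.2 then none else some y

theorem primrec_nonconstStep : Primrec fun a : (ℕ × ℕ) × ℕ => nonconstStep a.1.1 a.1.2 a.2 := by
  have hc : Primrec fun a : (ℕ × ℕ) × ℕ => Denumerable.ofNat Code a.1.1.unpair.1 :=
    (Primrec.ofNat Code).comp
      (Primrec.fst.comp (Primrec.unpair.comp (Primrec.fst.comp Primrec.fst)))
  have hk : Primrec fun a : (ℕ × ℕ) × ℕ => a.1.1.unpair.2 :=
    Primrec.snd.comp (Primrec.unpair.comp (Primrec.fst.comp Primrec.fst))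
  have hs : Primrec fun a : (ℕ × ℕ) × ℕ => a.2.unpair := Primrec.unpair.comp Primrec.snd
  have hx : Primrec fun a : (ℕ × ℕ) × ℕ => a.1.2 := Primrec.snd.comp Primrec.fst
  have ev {g : (ℕ × ℕ) × ℕ → ℕ} (hg : Primrec g) : Primrec fun a : (ℕ × ℕ) × ℕ =>
      evaln a.2.unpair.1 (Denumerable.ofNat Code a.1.1.unpair.1) (g a) :=
    Nat.Partrec.Code.primrec_evaln.comp (((Primrec.fst.comp hs).pair hc).pair hg)
  refine Primrec.option_bind (ev hx) (Primrec.ite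
    (Primrec.eq.comp (hk.comp Primrec.fst) (Primrec.const 0)) ?_
    (Primrec.ite (Primrec.eq.comp (Primrec.succ.comp (hx.comp Primrec.fst)) (hk.comp Primrec.fst))
      (Primrec.const none) (Primrec.option_some.comp Primrec.snd)))
  refine Primrec.option_bind ((ev (Primrec.snd.comp hs)).comp Primrec.fst) (Primrec.ite
    (PrimrecPred.and (Primrec.nat_lt.comp (hx.comp (Primrec.fst.comp Primrec.fst))
        (Primrec.snd.comp (hs.comp (Primrec.fst.comp Primrec.fst))))
      (PrimrecPred.not (Primrec.eq.comp (Primrec.snd.comp Primrec.fst) Primrec.snd)))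
    (Primrec.option_some.comp (Primrec.snd.comp Primrec.fst)) (Primrec.const none))

/-- An enumeration of the partial computable functions that are not total and eventually
constant. -/
def nonconst (e x : ℕ) : Part ℕ := Nat.rfindOpt (nonconstStep e x)

theorem partrec_nonconst : Partrec₂ nonconst :=
  Partrec.rfindOpt primrec_nonconstStep.to_comp

theorem eval_of_mem_nonconstStep {e x s y : ℕ} (h : y ∈ nonconstStep e x s) :
    y ∈ eval (Denumerable.ofNat Code e.unpair.1) x := by
  simp only [nonconstStep, Option.mem_def, Option.bind_eq_some_iff] at h
  obtain ⟨y', hy, h⟩ := h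
  have : y' = y := by
    split_ifs at h
    · obtain ⟨z, -, h⟩ := Option.bind_eq_some_iff.1 h
      split_ifs at h
      exact Option.some.inj h
    · exact Option.some.inj h
  exact this ▸ Nat.Partrec.Code.evaln_sound hy

theorem mem_nonconst {e x y : ℕ} : y ∈ nonconst e x ↔ ∃ s, y ∈ nonconstStep e x s :=
  Nat.mem_rfindOpt_iff_of_unique fun h h' =>
    Part.mem_unique (eval_of_mem_nonconstStep h) (eval_of_mem_nonconstStep h')

theorem mem_nonconst_pair_zero {c : Code} {x y : ℕ} :
    y ∈ nonconst (Nat.pair (Encodable.encode c) 0) x ↔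
      y ∈ eval c x ∧ ∃ m > x, ∃ z ∈ eval c m, y ≠ z := by
  rw [mem_nonconst]
  constructor
  · rintro ⟨s, hs⟩
    refine ⟨by simpa using eval_of_mem_nonconstStep hs, ?_⟩
    simp only [nonconstStep, Option.mem_def, Option.bind_eq_some_iff, Nat.unpair_pair,
      Denumerable.ofNat_encode, if_true] at hs
    obtain ⟨y', hy, z, hz, h⟩ := hs
    split_ifs at h with h'
    cases h
    exact ⟨_, h'.1, z, Nat.Partrec.Code.evaln_sound hz, h'.2⟩
  · rintro ⟨hy, m, hm, z, hz, hne⟩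
    obtain ⟨s, hs⟩ := Nat.Partrec.Code.evaln_complete.1 hy
    obtain ⟨t, ht⟩ := Nat.Partrec.Code.evaln_complete.1 hz
    have hs' := Nat.Partrec.Code.evaln_mono (le_max_left s t) hs
    have ht' := Nat.Partrec.Code.evaln_mono (le_max_right s t) ht
    refine ⟨Nat.pair (max s t) m, ?_⟩
    rw [Option.mem_def] at hs' ht'
    simp [nonconstStep, hs', ht', hm, hne]

theorem mem_nonconst_pair_succ {c : Code} {n x y : ℕ} :
    y ∈ nonconst (Nat.pair (Encodable.encode c) (n + 1)) x ↔ y ∈ eval c x ∧ x ≠ n := by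
  rw [mem_nonconst]
  constructor
  · rintro ⟨s, hs⟩
    refine ⟨by simpa using eval_of_mem_nonconstStep hs, ?_⟩
    rintro rfl
    simp [nonconstStep] at hs
  · rintro ⟨hy, hne⟩
    obtain ⟨s, hs⟩ := Nat.Partrec.Code.evaln_complete.1 hy
    refine ⟨Nat.pair s 0, ?_⟩
    rw [Option.mem_def] at hs
    simp [nonconstStep, hs, hne]

theorem not_eventuallyConst_nonconst (e : ℕ) : ¬ EventuallyConst (nonconst e) := by
  rintro ⟨p, hp⟩
  obtain ⟨c, k, rfl⟩ : ∃ (c : Code) (k : ℕ), e = Nat.pair (Encodable.encode c) k :=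
    ⟨Denumerable.ofNat Code e.unpair.1, e.unpair.2, by simp⟩
  have hmem (x : ℕ) : eventuallyConst p x ∈ nonconst (Nat.pair (Encodable.encode c) k) x := by
    rw [congrFun hp x]
    exact Part.mem_some _
  cases k with
  | zero =>
    obtain ⟨h, m, hm, z, hz, hne⟩ := mem_nonconst_pair_zero.1 (hmem p.1.length)
    have hm' := (mem_nonconst_pair_zero.1 (hmem m)).1
    refine hne ?_
    rw [Part.mem_unique hz hm', eventuallyConst_of_length_le le_rfl,
      eventuallyConst_of_length_le hm.le]
  | succ n => exact (mem_nonconst_pair_succ.1 (hmem n)).2 rfl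

/-- If `f` is total, each value is followed by a different one, so the demand removes nothing. If
`f` is undefined at `n`, neither does deleting `n`. -/
theorem exists_nonconst_eq {f : ℕ →. ℕ} (hf : Nat.Partrec f) (hc : ¬ EventuallyConst f) :
    ∃ e, nonconst e = f := by
  obtain ⟨c, rfl⟩ := Nat.Partrec.Code.exists_code.1 hf
  by_cases ht : ∀ x, (eval c x).Dom
  · refine ⟨Nat.pair (Encodable.encode c) 0, funext fun x => Part.ext fun y => ?_⟩
    rw [mem_nonconst_pair_zero]
    refine and_iff_left_of_imp fun hy => ?_
    by_contra! hn
    refine hc ⟨((List.range x).map fun i => (eval c i).get (ht i), y), funext fun i => ?_⟩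
    rw [Part.eq_some_iff]
    rcases lt_trichotomy i x with hi | rfl | hi
    · simpa [eventuallyConst, List.getD, hi] using Part.get_mem (ht i)
    · rwa [eventuallyConst_of_length_le (by simp)]
    · rw [eventuallyConst_of_length_le (by simpa using hi.le), hn i hi _ (Part.get_mem (ht i))]
      exact Part.get_mem _
  · push Not at ht
    obtain ⟨n, hn⟩ := ht
    refine ⟨Nat.pair (Encodable.encode c) (n + 1), funext fun x => Part.ext fun y => ?_⟩
    rw [mem_nonconst_pair_succ]
    exact and_iff_left_of_imp fun hy hx => hn (hx ▸ hy.fst)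

theorem exists_primrec_nonconst_code : ∃ c : ℕ → Code, Primrec c ∧ ∀ e, eval (c e) = nonconst e := by
  obtain ⟨C, hC⟩ := Nat.Partrec.Code.exists_code.1 (Partrec₂.unpaired'.2 partrec_nonconst)
  refine ⟨C.curry, Nat.Partrec.Code.primrec₂_curry.comp (Primrec.const C) Primrec.id,
    fun e => funext fun x => ?_⟩
  simp [Nat.Partrec.Code.eval_curry, hC]

/-! ### The merged enumeration. -/

/-- The programs `c e'` and `c e` have the same outputs below `m` by stage `t`. -/
def AgreeBelow (c : ℕ → Code) (m t e' e : ℕ) : Prop :=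
  ∀ x ∈ List.range m, evaln t (c e') x = evaln t (c e) x

open Classical in
/-- A guess, improved at every stage `t`, of a bound below which the program `c e` differs from
all programs with a smaller index. -/
noncomputable def differenceGuess (c : ℕ → Code) (e t : ℕ) : ℕ :=
  -- The reset to `t + 1` exceeds every earlier guess, so no abandoned guess returns.
  Nat.rec 0 (fun t m => if ∃ e' ∈ List.range e, AgreeBelow c m t e' e then t + 1 else m) t

/-- By stage `s`, the guess `r` for the index `e` is known to be wrong. -/
def Refuted (c : ℕ → Code) (e r s : ℕ) : Prop := r ≤ s ∧ differenceGuess c e s ≠ r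

/-- `t` is the first stage at which the guess `r` for the index `e` is known to be wrong. -/
def RefutedFirstAt (c : ℕ → Code) (e r t : ℕ) : Prop :=
  Refuted c e r t ∧ ∀ s ∈ List.range t, ¬ Refuted c e r s

/-- The reduced code of an eventually constant function that extends the outputs of the program
`c e` by stage `t`, and whose eventual value codes `(e, r, t)`. -/
def markedCode (c : ℕ → Code) (e r t : ℕ) : List ℕ × ℕ :=
  -- By stage `t` only inputs below `t` have outputs. The extra last entry differs from the tail
  -- value, which makes the code reduced and its list nonempty.
  ((List.range t).map (fun x => (evaln t (c e) x).getD (Encodable.encode (e, r, t))) ++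
    [Encodable.encode (e, r, t) + 1], Encodable.encode (e, r, t))

/-- `p` is the marked code for a guess and the stage at which it is refuted. -/
def IsMarkedCode (c : ℕ → Code) (p : List ℕ × ℕ) : Prop :=
  RefutedFirstAt c (Denumerable.ofNat (ℕ × ℕ × ℕ) p.2).1 (Denumerable.ofNat (ℕ × ℕ × ℕ) p.2).2.1
      (Denumerable.ofNat (ℕ × ℕ × ℕ) p.2).2.2 ∧
    p = markedCode c (Denumerable.ofNat (ℕ × ℕ × ℕ) p.2).1
      (Denumerable.ofNat (ℕ × ℕ × ℕ) p.2).2.1 (Denumerable.ofNat (ℕ × ℕ × ℕ) p.2).2.2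

open Classical in
/-- The function `eval (c e)`, except that it is turned into an eventually constant one when the
guess `r` is refuted. -/
noncomputable def guardedEval (c : ℕ → Code) (e r x : ℕ) : Part ℕ :=
  Nat.rfindOpt fun s =>
    if RefutedFirstAt c e r s then some (eventuallyConst (markedCode c e r s) x)
    else if Refuted c e r s then none else evaln s (c e) x

/-- An enumeration, by pairs of an index and a guess and by codes of eventually constant functions,
of the functions `eval (c e)` and the eventually constant functions. -/
noncomputable def mergedEnum (c : ℕ → Code) : (ℕ × ℕ) ⊕ (List ℕ × ℕ) → ℕ →. ℕ
  | .inl q => guardedEval c q.1 q.2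
  | .inr p => fun x => Part.some (eventuallyConst p x)

/-- The indices to which `mergedEnum` is restricted to make it injective. -/
def IsMergedIndex (c : ℕ → Code) : (ℕ × ℕ) ⊕ (List ℕ × ℕ) → Prop
  | .inl _ => True
  | .inr p => IsReducedCode p ∧ ¬ IsMarkedCode c p

/-! ### Effectiveness of the merged enumeration. -/

section Primrec

variable {c : ℕ → Code} (hc : Primrec c)
include hc

theorem primrec_evaln_comp : Primrec fun a : (ℕ × ℕ) × ℕ => evaln a.1.1 (c a.1.2) a.2 :=
  Nat.Partrec.Code.primrec_evaln.comp (((Primrec.fst.comp Primrec.fst).pair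
    (hc.comp (Primrec.snd.comp Primrec.fst))).pair Primrec.snd)

theorem primrecPred_agreeBelow :
    PrimrecPred fun a : (ℕ × ℕ) × ℕ × ℕ => AgreeBelow c a.1.1 a.1.2 a.2.1 a.2.2 := by
  have h : PrimrecRel fun (x : ℕ) (a : ℕ × ℕ × ℕ) =>
      evaln a.1 (c a.2.1) x = evaln a.1 (c a.2.2) x := by
    refine Primrec.eq.comp
      ((primrec_evaln_comp hc).comp (((Primrec.fst.comp Primrec.snd).pair
        (Primrec.fst.comp (Primrec.snd.comp Primrec.snd))).pair Primrec.fst))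
      ((primrec_evaln_comp hc).comp (((Primrec.fst.comp Primrec.snd).pair
        (Primrec.snd.comp (Primrec.snd.comp Primrec.snd))).pair Primrec.fst))
  exact h.forall_mem_list.comp (Primrec.list_range.comp (Primrec.fst.comp Primrec.fst))
    ((Primrec.snd.comp Primrec.fst).pair Primrec.snd)

theorem primrec_differenceGuess : Primrec₂ (differenceGuess c) := by
  classical
  have h : PrimrecRel fun (e' : ℕ) (a : (ℕ × ℕ) × ℕ) => AgreeBelow c a.1.1 a.1.2 e' a.2 :=
    (primrecPred_agreeBelow hc).comp ((Primrec.fst.comp Primrec.snd).pair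
      (Primrec.fst.pair (Primrec.snd.comp Primrec.snd)))
  have ht : Primrec fun b : (ℕ × ℕ) × ℕ × ℕ => b.2.1 := Primrec.fst.comp Primrec.snd
  have hm : Primrec fun b : (ℕ × ℕ) × ℕ × ℕ => b.2.2 := Primrec.snd.comp Primrec.snd
  have he : Primrec fun b : (ℕ × ℕ) × ℕ × ℕ => b.1.1 := Primrec.fst.comp Primrec.fst
  have hp : PrimrecPred fun b : (ℕ × ℕ) × ℕ × ℕ =>
      ∃ e' ∈ List.range b.1.1, AgreeBelow c b.2.2 b.2.1 e' b.1.1 :=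
    h.exists_mem_list.comp (Primrec.list_range.comp he) ((hm.pair ht).pair he)
  exact Primrec.nat_rec' (f := fun a : ℕ × ℕ => a.2) Primrec.snd (Primrec.const 0)
    (h := fun a b => if ∃ e' ∈ List.range a.1, AgreeBelow c b.2 b.1 e' a.1 then b.1 + 1 else b.2)
    (Primrec.ite hp (Primrec.succ.comp ht) hm)

theorem primrecPred_refuted : PrimrecPred fun a : (ℕ × ℕ) × ℕ => Refuted c a.1.1 a.1.2 a.2 :=
  PrimrecPred.and (Primrec.nat_le.comp (Primrec.snd.comp Primrec.fst) Primrec.snd)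
    (PrimrecPred.not (Primrec.eq.comp ((primrec_differenceGuess hc).comp
      (Primrec.fst.comp Primrec.fst) Primrec.snd) (Primrec.snd.comp Primrec.fst)))

theorem primrecPred_refutedFirstAt :
    PrimrecPred fun a : (ℕ × ℕ) × ℕ => RefutedFirstAt c a.1.1 a.1.2 a.2 := by
  have h : PrimrecRel fun (s : ℕ) (a : ℕ × ℕ) => ¬ Refuted c a.1 a.2 s :=
    (PrimrecPred.not (primrecPred_refuted hc)).comp (Primrec.snd.pair Primrec.fst)
  exact (primrecPred_refuted hc).and
    (h.forall_mem_list.comp (Primrec.list_range.comp Primrec.snd) Primrec.fst)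

theorem primrec_markedCode : Primrec fun a : (ℕ × ℕ) × ℕ => markedCode c a.1.1 a.1.2 a.2 := by
  have hk : Primrec fun a : (ℕ × ℕ) × ℕ => Encodable.encode (a.1.1, a.1.2, a.2) :=
    Primrec.encode.comp ((Primrec.fst.comp Primrec.fst).pair
      ((Primrec.snd.comp Primrec.fst).pair Primrec.snd))
  refine Primrec.pair (Primrec.list_concat.comp (Primrec.list_map
    (Primrec.list_range.comp Primrec.snd) (Primrec.option_getD.comp ?_ (hk.comp Primrec.fst)))
    (Primrec.succ.comp hk)) hk
  exact (primrec_evaln_comp hc).comp (((Primrec.snd.comp Primrec.fst).pair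
    (Primrec.fst.comp (Primrec.fst.comp Primrec.fst))).pair Primrec.snd)

theorem primrecPred_isMarkedCode : PrimrecPred (IsMarkedCode c) := by
  have hd : Primrec fun p : List ℕ × ℕ => Denumerable.ofNat (ℕ × ℕ × ℕ) p.2 :=
    (Primrec.ofNat (ℕ × ℕ × ℕ)).comp Primrec.snd
  have hd' : Primrec fun p : List ℕ × ℕ =>
      (((Denumerable.ofNat (ℕ × ℕ × ℕ) p.2).1, (Denumerable.ofNat (ℕ × ℕ × ℕ) p.2).2.1),
        (Denumerable.ofNat (ℕ × ℕ × ℕ) p.2).2.2) :=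
    ((Primrec.fst.comp hd).pair (Primrec.fst.comp (Primrec.snd.comp hd))).pair
      (Primrec.snd.comp (Primrec.snd.comp hd))
  exact ((primrecPred_refutedFirstAt hc).comp hd').and
    (Primrec.eq.comp Primrec.id ((primrec_markedCode hc).comp hd'))

theorem primrecPred_isMergedIndex : PrimrecPred (IsMergedIndex c) := by
  classical
  have h : PrimrecPred fun p => IsReducedCode p ∧ ¬ IsMarkedCode c p :=
    primrecPred_isReducedCode.and (primrecPred_isMarkedCode hc).not
  refine Primrec.primrecPred ((Primrec.sumCasesOn Primrec.id
    (g := fun _ _ => true) (Primrec.const true)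
    (h := fun _ p => decide (IsReducedCode p ∧ ¬ IsMarkedCode c p))
    (h.decide.comp Primrec.snd)).of_eq fun i => ?_)
  rcases i with q | p
  · exact (decide_eq_true (show IsMergedIndex c (.inl q) from trivial)).symm
  · exact decide_eq_decide.2 Iff.rfl

theorem partrec_guardedEval : Partrec₂ fun q : ℕ × ℕ => guardedEval c q.1 q.2 := by
  classical
  have h₁ : Primrec fun a : ((ℕ × ℕ) × ℕ) × ℕ => (a.1.1, a.2) :=
    (Primrec.fst.comp Primrec.fst).pair Primrec.snd
  exact Partrec.rfindOpt (Primrec.to_comp (Primrec.ite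
    ((primrecPred_refutedFirstAt hc).comp h₁)
    (Primrec.option_some.comp (primrec_eventuallyConst.comp
      ((primrec_markedCode hc).comp h₁) (Primrec.snd.comp Primrec.fst)))
    (Primrec.ite ((primrecPred_refuted hc).comp h₁) (Primrec.const none)
      ((primrec_evaln_comp hc).comp ((Primrec.snd.pair
        (Primrec.fst.comp (Primrec.fst.comp Primrec.fst))).pair (Primrec.snd.comp Primrec.fst))))))

theorem partrec_mergedEnum : Partrec₂ (mergedEnum c) :=
  (Partrec.sumCasesOn (f := fun a : ((ℕ × ℕ) ⊕ (List ℕ × ℕ)) × ℕ => a.1)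
    (g := fun a q => guardedEval c q.1 q.2 a.2)
    (h := fun a p => Part.some (eventuallyConst p a.2))
    Computable.fst
    ((partrec_guardedEval hc).comp Computable.snd (Computable.snd.comp Computable.fst))
    (Computable.partrec (primrec_eventuallyConst.to_comp.comp Computable.snd
      (Computable.snd.comp Computable.fst)))).of_eq fun a => by
    rcases a with ⟨_ | _, _⟩ <;> rfl

end Primrec

/-! ### Convergence and refutation of guesses. -/

section Guess

variable {c : ℕ → Code} {e r s t : ℕ}

theorem differenceGuess_succ_of_agree (h : ∃ e' < e, AgreeBelow c (differenceGuess c e t) t e' e) :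
    differenceGuess c e (t + 1) = t + 1 :=
  if_pos (h.imp fun _ => And.imp_left List.mem_range.2)

theorem differenceGuess_succ_of_not_agree
    (h : ¬ ∃ e' < e, AgreeBelow c (differenceGuess c e t) t e' e) :
    differenceGuess c e (t + 1) = differenceGuess c e t :=
  if_neg fun h' => h (h'.imp fun _ => And.imp_left List.mem_range.1)

/-- A change at stage `s` moves the guess to `s + 1`, which is beyond `r ≤ s`. -/
theorem Refuted.succ (h : Refuted c e r s) : Refuted c e r (s + 1) := by
  refine ⟨h.1.trans s.le_succ, ?_⟩
  by_cases h' : ∃ e' < e, AgreeBelow c (differenceGuess c e s) s e' e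
  · rw [differenceGuess_succ_of_agree h']
    have := h.1
    omega
  · rw [differenceGuess_succ_of_not_agree h']
    exact h.2

theorem Refuted.mono (h : Refuted c e r s) (hst : s ≤ t) : Refuted c e r t :=
  Nat.le_induction h (fun _ _ => Refuted.succ) t hst

theorem Refuted.exists_refutedFirstAt (h : Refuted c e r s) : ∃ t, RefutedFirstAt c e r t := by
  classical
  exact ⟨Nat.find ⟨s, h⟩, Nat.find_spec ⟨s, h⟩,
    fun i hi => Nat.find_min ⟨s, h⟩ (List.mem_range.1 hi)⟩

theorem RefutedFirstAt.eq (hs : RefutedFirstAt c e r s) (ht : RefutedFirstAt c e r t) : s = t := by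
  rcases lt_trichotomy s t with h | h | h
  · exact absurd hs.1 (ht.2 s (List.mem_range.2 h))
  · exact h
  · exact absurd ht.1 (hs.2 t (List.mem_range.2 h))

theorem eq_of_forall_not_refuted (hr : ∀ t, ¬ Refuted c e r t) (hs : ∀ t, ¬ Refuted c e s t) :
    r = s := by
  have h₁ : differenceGuess c e (max r s) = r := by
    by_contra h
    exact hr _ ⟨le_max_left _ _, h⟩
  have h₂ : differenceGuess c e (max r s) = s := by
    by_contra h
    exact hs _ ⟨le_max_right _ _, h⟩
  exact h₁.symm.trans h₂

theorem eventually_evaln_eq (a b : Code) (x : ℕ) (h : eval a x = eval b x) :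
    ∃ t₀, ∀ t ≥ t₀, evaln t a x = evaln t b x := by
  by_cases hd : ∃ y, y ∈ eval a x
  · obtain ⟨y, hy⟩ := hd
    obtain ⟨s, hs⟩ := Nat.Partrec.Code.evaln_complete.1 hy
    obtain ⟨t, ht⟩ := Nat.Partrec.Code.evaln_complete.1 (h ▸ hy)
    refine ⟨max s t, fun u hu => ?_⟩
    rw [Option.mem_def.1 (Nat.Partrec.Code.evaln_mono ((le_max_left s t).trans hu) hs),
      Option.mem_def.1 (Nat.Partrec.Code.evaln_mono ((le_max_right s t).trans hu) ht)]
  · have none_of {d : Code} (hd : ¬ ∃ y, y ∈ eval d x) (t : ℕ) : evaln t d x = none :=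
      Option.eq_none_iff_forall_not_mem.2 fun y hy =>
        hd ⟨y, Nat.Partrec.Code.evaln_sound hy⟩
    exact ⟨0, fun t _ => by rw [none_of hd, none_of (h ▸ hd)]⟩

theorem eventually_evaln_ne (a b : Code) (x : ℕ) (h : eval a x ≠ eval b x) :
    ∃ t₀, ∀ t ≥ t₀, evaln t a x ≠ evaln t b x := by
  have aux {a b : Code} {y : ℕ} (hy : y ∈ eval a x) (hy' : y ∉ eval b x) :
      ∃ t₀, ∀ t ≥ t₀, evaln t a x ≠ evaln t b x := by
    obtain ⟨s, hs⟩ := Nat.Partrec.Code.evaln_complete.1 hy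
    exact ⟨s, fun t ht he => hy' (Nat.Partrec.Code.evaln_sound
      (he ▸ Nat.Partrec.Code.evaln_mono ht hs))⟩
  by_contra hn
  refine h (Part.ext fun y => ⟨fun hy => ?_, fun hy => ?_⟩)
  · by_contra hy'
    exact hn (aux hy hy')
  · by_contra hy'
    obtain ⟨t₀, ht⟩ := aux hy hy'
    exact hn ⟨t₀, fun t h => (ht t h).symm⟩

/-- An unrefuted guess would stay `r` forever, but equal programs eventually agree at every stage on
the finitely many inputs below `r`, which forces a reset. -/
theorem exists_refuted_of_eval_eq {e' : ℕ} (he : e' < e) (h : eval (c e') = eval (c e)) (r : ℕ) :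
    ∃ t, Refuted c e r t := by
  by_contra! hn
  have hr (t : ℕ) (ht : r ≤ t) : differenceGuess c e t = r := by
    by_contra h
    exact hn t ⟨ht, h⟩
  choose u hu using fun x => eventually_evaln_eq (c e') (c e) x (congrFun h x)
  set t := max r ((Finset.range r).sup u)
  have hag : ∃ e' < e, AgreeBelow c (differenceGuess c e t) t e' e := by
    refine ⟨e', he, fun x hx => hu x t ?_⟩
    rw [hr t (le_max_left _ _), List.mem_range] at hx
    exact (Finset.le_sup (Finset.mem_range.2 hx)).trans (le_max_right _ _)
  have h₁ := differenceGuess_succ_of_agree hag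
  have h₂ : r ≤ t := le_max_left _ _
  rw [hr (t + 1) (h₂.trans t.le_succ)] at h₁
  omega

/-- Let `t₁` bound, for all `e' < e`, a place where `e'` and `e` differ and a stage from which this
is visible. After `t₁` a guess above `t₁` is never changed, and any change produces such a guess. -/
theorem exists_forall_not_refuted (h : ∀ e' < e, eval (c e') ≠ eval (c e)) :
    ∃ r, ∀ t, ¬ Refuted c e r t := by
  have hx : ∀ e', ∃ x t₀, e' < e → ∀ t ≥ t₀, evaln t (c e') x ≠ evaln t (c e) x := by
    intro e'
    by_cases he : e' < e
    · obtain ⟨x, hx⟩ := Function.ne_iff.1 (h e' he)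
      obtain ⟨t, ht⟩ := eventually_evaln_ne _ _ x hx
      exact ⟨x, t, fun _ => ht⟩
    · exact ⟨0, 0, fun h => absurd h he⟩
  choose x u hu using hx
  set t₁ := max ((Finset.range e).sup u) ((Finset.range e).sup x)
  have stable (t : ℕ) (ht : t₁ ≤ t) (hm : t₁ < differenceGuess c e t) :
      differenceGuess c e (t + 1) = differenceGuess c e t := by
    refine differenceGuess_succ_of_not_agree fun ⟨e', he, hag⟩ => ?_
    have hmem := Finset.mem_range.2 he
    refine hu e' he t (((Finset.le_sup hmem).trans (le_max_left _ _)).trans ht)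
      (hag (x e') (List.mem_range.2 ?_))
    exact ((Finset.le_sup hmem).trans (le_max_right _ _)).trans_lt hm
  suffices ∃ T, ∀ t ≥ T, differenceGuess c e t = differenceGuess c e T by
    obtain ⟨T, hT⟩ := this
    refine ⟨differenceGuess c e T, fun t ht => ?_⟩
    exact (ht.mono (le_max_left t T)).2 (hT _ (le_max_right t T))
  by_cases hc : ∃ t ≥ t₁, t₁ < differenceGuess c e t
  · obtain ⟨T, hT, hm⟩ := hc
    refine ⟨T, fun t ht => Nat.le_induction rfl (fun t ht ih => ?_) t ht⟩
    rw [stable t (hT.trans ht) (ih ▸ hm), ih]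
  · push Not at hc
    refine ⟨t₁, fun t ht => Nat.le_induction rfl (fun t ht ih => ?_) t ht⟩
    by_cases ha : ∃ e' < e, AgreeBelow c (differenceGuess c e t) t e' e
    · have := hc (t + 1) (ht.trans t.le_succ)
      rw [differenceGuess_succ_of_agree ha] at this
      omega
    · rw [differenceGuess_succ_of_not_agree ha, ih]

theorem isReducedCode_markedCode (c : ℕ → Code) (e r t : ℕ) : IsReducedCode (markedCode c e r t) := by
  simp [IsReducedCode, markedCode]

/-- The tail value of a marked code determines its triple, so the unbounded existential is
decidable. -/
theorem isMarkedCode_iff {p : List ℕ × ℕ} :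
    IsMarkedCode c p ↔ ∃ e r t, RefutedFirstAt c e r t ∧ p = markedCode c e r t := by
  constructor
  · exact fun h => ⟨_, _, _, h⟩
  · rintro ⟨e, r, t, h, rfl⟩
    simpa [IsMarkedCode, markedCode] using h

theorem eventuallyConst_markedCode {x y : ℕ} (hs : s ≤ t) (h : y ∈ evaln s (c e) x) :
    eventuallyConst (markedCode c e r t) x = y := by
  have hx : x < t := (Nat.Partrec.Code.evaln_bound h).trans_le hs
  have ht := Option.mem_def.1 (Nat.Partrec.Code.evaln_mono hs h)
  simp [eventuallyConst, markedCode, List.getD, List.getElem?_append_left, hx, ht]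

/-- Outputs released before stage `t` are among those that the marked code extends, later stages
release nothing, and stage `t` itself makes the function total. -/
theorem guardedEval_of_refutedFirstAt (h : RefutedFirstAt c e r t) :
    guardedEval c e r = fun x => Part.some (eventuallyConst (markedCode c e r t) x) := by
  classical
  funext x
  rw [Part.eq_some_iff]
  have key : ∀ s y, y ∈ (if RefutedFirstAt c e r s then
      some (eventuallyConst (markedCode c e r s) x)
      else if Refuted c e r s then none else evaln s (c e) x) →
      y = eventuallyConst (markedCode c e r t) x := by
    intro s y hy
    split_ifs at hy with h₁ h₂
    · rw [← Option.some.inj hy, h₁.eq h]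
    · cases hy
    · refine (eventuallyConst_markedCode ?_ hy).symm
      by_contra! hts
      exact h₂ (h.1.mono hts.le)
  refine (Nat.mem_rfindOpt_iff_of_unique fun h h' => (key _ _ h).trans (key _ _ h').symm).2 ⟨t, ?_⟩
  rw [if_pos h]
  rfl

theorem guardedEval_of_forall_not_refuted (h : ∀ t, ¬ Refuted c e r t) :
    guardedEval c e r = eval (c e) := by
  funext x
  rw [Nat.Partrec.Code.eval_eq_rfindOpt, guardedEval]
  congr 1
  funext s
  rw [if_neg fun h' => h s h'.1, if_neg (h s)]

end Guess

/-! ### Each function occurs exactly once. -/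

section MergedEnum

variable {c : ℕ → Code}

theorem guardedEval_eq_or (c : ℕ → Code) (e r : ℕ) :
    ((∀ t, ¬ Refuted c e r t) ∧ guardedEval c e r = eval (c e)) ∨
      ∃ t, RefutedFirstAt c e r t ∧
        guardedEval c e r = fun x => Part.some (eventuallyConst (markedCode c e r t) x) := by
  by_cases h : ∀ t, ¬ Refuted c e r t
  · exact .inl ⟨h, guardedEval_of_forall_not_refuted h⟩
  · push Not at h
    obtain ⟨s, hs⟩ := h
    obtain ⟨t, ht⟩ := hs.exists_refutedFirstAt
    exact .inr ⟨t, ht, guardedEval_of_refutedFirstAt ht⟩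

theorem IsReducedCode.eq_of_some {p q : List ℕ × ℕ} (hp : IsReducedCode p) (hq : IsReducedCode q)
    (h : (fun x => Part.some (eventuallyConst p x)) = fun x => Part.some (eventuallyConst q x)) :
    p = q :=
  hp.eq hq (funext fun x => Part.some_inj.1 (congrFun h x))

/-- Surviving guesses belong to least indices and are unique there; refuted ones are told apart by
the triple in the tail, and their codes are excluded from the right summand. -/
theorem injOn_mergedEnum (hc : ∀ e, ¬ EventuallyConst (eval (c e))) :
    Set.InjOn (mergedEnum c) {i | IsMergedIndex c i} := by
  have mixed {e r : ℕ} {p : List ℕ × ℕ} (hp : IsMergedIndex c (.inr p))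
      (h : guardedEval c e r = fun x => Part.some (eventuallyConst p x)) : False := by
    rcases guardedEval_eq_or c e r with ⟨-, he⟩ | ⟨t, ht, he⟩
    · exact hc e ⟨p, he.symm.trans h⟩
    · exact hp.2 (isMarkedCode_iff.2 ⟨e, r, t, ht,
        hp.1.eq_of_some (isReducedCode_markedCode c e r t) (h.symm.trans he)⟩)
  rintro (⟨e, r⟩ | p) hi (⟨e', r'⟩ | p') hj h
  · change guardedEval c e r = guardedEval c e' r' at h
    rcases guardedEval_eq_or c e r with ⟨hr, he⟩ | ⟨t, ht, he⟩ <;>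
      rcases guardedEval_eq_or c e' r' with ⟨hr', he'⟩ | ⟨t', ht', he'⟩
    · have hee : eval (c e) = eval (c e') := he.symm.trans (h.trans he')
      obtain rfl : e = e' := by
        rcases lt_trichotomy e e' with hlt | heq | hlt
        · obtain ⟨t, ht⟩ := exists_refuted_of_eval_eq hlt hee r'
          exact absurd ht (hr' t)
        · exact heq
        · obtain ⟨t, ht⟩ := exists_refuted_of_eval_eq hlt hee.symm r
          exact absurd ht (hr t)
      rw [eq_of_forall_not_refuted hr hr']
    · exact absurd ⟨_, he.symm.trans (h.trans he')⟩ (hc e)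
    · exact absurd ⟨_, he'.symm.trans (h.symm.trans he)⟩ (hc e')
    · have hm := congrArg Prod.snd ((isReducedCode_markedCode c e r t).eq_of_some
        (isReducedCode_markedCode c e' r' t') (he.symm.trans (h.trans he')))
      have hm' : (e, r, t) = (e', r', t') := Encodable.encode_injective hm
      simp only [Prod.mk.injEq] at hm'
      rw [hm'.1, hm'.2.1]
  · exact (mixed hj h).elim
  · exact (mixed hi h.symm).elim
  · exact congrArg _ (hi.1.eq_of_some hj.1 h)

theorem exists_mergedEnum_eq {f : ℕ →. ℕ} (hf : EventuallyConst f ∨ ∃ e, eval (c e) = f) :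
    ∃ i, IsMergedIndex c i ∧ mergedEnum c i = f := by
  classical
  rcases hf with hf | hf
  · obtain ⟨p, hp, rfl⟩ := hf.exists_isReducedCode
    by_cases hm : IsMarkedCode c p
    · obtain ⟨e, r, t, ht, rfl⟩ := isMarkedCode_iff.1 hm
      exact ⟨.inl (e, r), trivial, guardedEval_of_refutedFirstAt ht⟩
    · exact ⟨.inr p, ⟨hp, hm⟩, rfl⟩
  · obtain ⟨r, hr⟩ := exists_forall_not_refuted (c := c) (e := Nat.find hf)
      fun e' he' h => Nat.find_min hf he' (h.trans (Nat.find_spec hf))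
    exact ⟨.inl (Nat.find hf, r), trivial,
      (guardedEval_of_forall_not_refuted hr).trans (Nat.find_spec hf)⟩

/-- Marked codes have nonempty lists. This keeps the indices of constant functions computable. -/
theorem isMergedIndex_const (c : ℕ → Code) (a : ℕ) : IsMergedIndex c (.inr ([], a)) := by
  refine ⟨by simp [IsReducedCode], fun h => ?_⟩
  obtain ⟨e, r, t, -, h⟩ := isMarkedCode_iff.1 h
  simp [markedCode] at h

end MergedEnum

/-! ### The enumeration with a combinator `k`, and the conclusion. -/

/-- A Friedberg enumeration in which indices of the constant functions can be computed. -/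
theorem exists_isOneOneComputableEnumeration_const :
    ∃ ψ : ℕ → ℕ →. ℕ, IsOneOneComputableEnumeration ψ ∧
      ∃ g : ℕ → ℕ, Computable g ∧ ∀ a x, ψ (g a) x = Part.some a := by
  classical
  obtain ⟨c, hcp, hc⟩ := exists_primrec_nonconst_code
  have hnc (e : ℕ) : ¬ EventuallyConst (eval (c e)) := hc e ▸ not_eventuallyConst_nonconst e
  let I := (ℕ × ℕ) ⊕ (List ℕ × ℕ)
  let p : ℕ → Prop := fun n => IsMergedIndex c (Denumerable.ofNat I n)
  have hp : PrimrecPred p := (primrecPred_isMergedIndex hcp).comp (Primrec.ofNat I)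
  have hconst (a : ℕ) : p (Encodable.encode (.inr ([], a) : I)) := by
    simpa only [p, Denumerable.ofNat_encode] using isMergedIndex_const c a
  have hinf : {n | p n}.Infinite := by
    refine Set.infinite_of_injective_forall_mem
      (f := fun a : ℕ => Encodable.encode (.inr ([], a) : I)) (fun a b h => ?_) hconst
    simpa using Encodable.encode_injective h
  have hmem (n : ℕ) : p (Nat.nth p n) := Nat.nth_mem_of_infinite hinf n
  -- `Nat.nth p` renumbers the admissible indices by `ℕ`; `Nat.count p` inverts it on them.
  refine ⟨fun n => mergedEnum c (Denumerable.ofNat I (Nat.nth p n)), ⟨?_, ?_, ?_⟩,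
    fun a => Nat.count p (Encodable.encode (.inr ([], a) : I)), ?_, fun a x => ?_⟩
  · exact (partrec_mergedEnum hcp).comp
      ((Computable.ofNat I).comp ((Computable.nth hp hinf).comp Computable.fst)) Computable.snd
  · intro m n h
    exact Nat.nth_injective hinf ((Denumerable.eqv I).symm.injective
      (injOn_mergedEnum hnc (hmem m) (hmem n) h))
  · intro f hf
    have hor : EventuallyConst f ∨ ∃ e, eval (c e) = f := by
      refine or_iff_not_imp_left.2 fun h => ?_
      obtain ⟨e, he⟩ := exists_nonconst_eq hf h
      exact ⟨e, (hc e).trans he⟩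
    obtain ⟨i, hi, rfl⟩ := exists_mergedEnum_eq hor
    have hpi : p (Encodable.encode i) := by simpa only [p, Denumerable.ofNat_encode] using hi
    exact ⟨Nat.count p (Encodable.encode i), by
      simp only [Nat.nth_count hpi, Denumerable.ofNat_encode]⟩
  · exact (Primrec.count hp).to_comp.comp (Computable.encode.comp
      (Computable.sumInr.comp ((Computable.const []).pair Computable.id)))
  · simp only [Nat.nth_count (hconst a), Denumerable.ofNat_encode]
    simp [mergedEnum, eventuallyConst]

theorem theorem6p2 :
    (∃ ψ : ℕ → ℕ →. ℕ, IsOneOneComputableEnumeration ψ ∧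
      (enumerationPas ψ).Extensional ∧
      ∃ k : ℕ, (enumerationPas ψ).IsCombinatorK k) ∧
    (∀ ψ : ℕ → ℕ →. ℕ, IsOneOneComputableEnumeration ψ →
      ¬ ∃ s : ℕ, (enumerationPas ψ).IsCombinatorS s) := by
  refine ⟨?_, fun ψ hψ ⟨s, hs⟩ => hψ.not_isCombinatorS s hs⟩
  obtain ⟨ψ, hψ, g, hg, hgψ⟩ := exists_isOneOneComputableEnumeration_const
  obtain ⟨k, hk⟩ := hψ.complete (fun a => Part.some (g a)) (Partrec.nat_iff.1 hg.partrec)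
  refine ⟨ψ, hψ, fun m n h => hψ.injective (funext h), k, fun a => ?_, fun a b => ?_⟩
  · simp [enumerationPas, hk]
  · simp [enumerationPas, PartialApplicativeStructure.sapp, hk, hgψ]
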